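/- Let $k\ge 1$ and $p\ge 1$ be integers. Consider a grid $t_{n-i}=t_n-c_i h_n$, $i=-1,\dots,k-1$, where $h_n=t_{n+1}-t_n>0$ and the step fractions satisfy $-1=c_{-1}<0=c_0<c_1<\dots<c_{k-1}$. A variable-step $k$-step LIMM method (linearly implicit multistep method) with exact Jacobian for an autonomous system $y'=f(y)$ computes $y_{n+1}$ from $y_n,\dots,y_{n-k+1}$ by $$\sum_{i=-1}^{k-1}\alpha_i\,y_{n-i}=h_n\sum_{i=0}^{k-1}\beta_i\,f(y_{n-i})+h_n\,\mathbf J_n\Big(\sum_{i=-1}^{k-1}\mu_i\,y_{n-i}+h_n\sum_{i=0}^{k-1}\nu_i\,f(y_{n-i})\Big),\qquad \mathbf J_n=f_y(y_n),\quad \alpha_{-1}=1,$$ where the real coefficients $\alpha_i,\beta_i,\mu_i,\nu_i$ may depend on the step fractions. At given step fractions, the method has order of consistency $p$ if, for every dimension $d$, every $C^\infty$ map $f:U\to\mathbb R^d$ on an open set $U\subseteq\mathbb R^d$, every solution $y$ of $y'=f(y)$ on an open interval and every $t_n$ in that interval, the following holds: for all sufficiently small $h_n>0$ the equation above with exact past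 values $y_{n-i}=y(t_n-c_ih_n)$, $i=0,\dots,k-1$, has exactly one solution $y_{n+1}$, and $y_{n+1}-y(t_n+h_n)=\mathcal O(h_n^{p+1})$ as $h_n\to0$ with the $c_i$ fixed. **Theorem (LIMM order conditions).** For any given step fractions, the method has order of consistency $p$ if and only if its coefficients satisfy $$\sum_{i=-1}^{k-1}\alpha_i=0,\qquad \sum_{i=-1}^{k-1}\mu_i=0,\qquad \sum_{i=-1}^{k-1}\alpha_i c_i+\sum_{i=0}^{k-1}\beta_i=0,$$ if $p\ge2$, also $$\sum_{i=-1}^{k-1}\alpha_i c_i^2+2\Big(\sum_{i=0}^{k-1}\beta_i c_i+\sum_{i=-1}^{k-1}\mu_i c_i-\sum_{i=0}^{k-1}\nu_i\Big)=0,$$ and, for every integer $\ell$ with $3\le\ell\le p$, $$\sum_{i=-1}^{k-1}\alpha_i c_i^{\ell}+\ell\sum_{i=0}^{k-1}\beta_i c_i^{\ell-1}=0,\qquad \sum_{i=-1}^{k-1}\mu_i c_i^{\ell-1}-(\ell-1)\sum_{i=0}^{k-1}\nu_i c_i^{\ell-2}=0.$$ -/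

import Mathlib

open Finset
open scoped ContDiff

/-- Step fractions of a grid `t_{n-i} = t_n - c_i h_n`, `i = -1, …, k-1`, where
`h_n = t_{n+1} - t_n`; so `c_{-1} = -1`, `c_0 = 0`, and the grid times are strictly ordered. -/
structure StepFractions (k : ℕ) where
  c : ℤ → ℝ
  neg_one : c (-1) = -1
  zero : c 0 = 0
  strictMonoOn : StrictMonoOn c (Set.Icc (-1) ((k : ℤ) - 1))

/-- Coefficients of a linearly implicit multistep method. With `k` steps, only the indices
`-1, …, k-1` (for `α`, `μ`) and `0, …, k-1` (for `β`, `ν`) are used. -/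
structure LimmCoeffs where
  α : ℤ → ℝ
  β : ℤ → ℝ
  μ : ℤ → ℝ
  ν : ℤ → ℝ
  α_neg_one : α (-1) = 1

/-- A variable-step `k`-step method: its coefficients may depend on the step fractions
in an arbitrary way. -/
abbrev VariableStepLimm (k : ℕ) := StepFractions k → LimmCoeffs

/-- One step of size `h` for the autonomous equation `y' = f(y)`. The value `Y i` stands for
`y_{n-i}`, so `Y (-1)` is the new value `y_{n+1}` and `fderiv ℝ f (Y 0)` is the exact
Jacobian `J_n = f_y(y_n)`. -/
def IsLimmStep {E : Type*} [NormedAddCommGroup E] [NormedSpace ℝ E]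
    (k : ℕ) (A : LimmCoeffs) (f : E → E) (h : ℝ) (Y : ℤ → E) : Prop :=
  ∑ i ∈ Icc (-1 : ℤ) (k - 1), A.α i • Y i =
    h • ∑ i ∈ Icc (0 : ℤ) (k - 1), A.β i • f (Y i) +
    h • fderiv ℝ f (Y 0)
      (∑ i ∈ Icc (-1 : ℤ) (k - 1), A.μ i • Y i +
        h • ∑ i ∈ Icc (0 : ℤ) (k - 1), A.ν i • f (Y i))

/-- The equation that determines `y_{n+1} = y₁` when the past values
`y_{n-i}`, `i = 0, …, k-1`, are the exact ones, `y (t_n - c_i h)`. -/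
def IsExactlyInitializedStep {E : Type*} [NormedAddCommGroup E] [NormedSpace ℝ E]
    {k : ℕ} (A : LimmCoeffs) (s : StepFractions k) (f : E → E) (y : ℝ → E)
    (t h : ℝ) (y₁ : E) : Prop :=
  IsLimmStep k A f h (Function.update (fun i => y (t - s.c i * h)) (-1) y₁)

/-- Order of consistency (at least) `p` at the step fractions `s`: for every smooth autonomous
system `y' = f(y)`, every solution `y` and every time `t` inside its interval of existence, the
method started from exact past values has, for all small step sizes `h > 0`, exactly one
numerical solution `y₁`, and the local truncation error `y₁ - y (t + h)` is `O(h ^ (p + 1))`. -/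
def VariableStepLimm.HasConsistencyOrder {k : ℕ} (M : VariableStepLimm k)
    (s : StepFractions k) (p : ℕ) : Prop :=
  ∀ (d : ℕ) (U : Set (EuclideanSpace ℝ (Fin d)))
    (f : EuclideanSpace ℝ (Fin d) → EuclideanSpace ℝ (Fin d)),
    IsOpen U → ContDiffOn ℝ ∞ f U →
    ∀ (a b : ℝ) (y : ℝ → EuclideanSpace ℝ (Fin d)),
      (∀ t ∈ Set.Ioo a b, y t ∈ U ∧ HasDerivAt y (f (y t)) t) →
      ∀ t ∈ Set.Ioo a b, ∃ C h₀ : ℝ, 0 < h₀ ∧ ∀ h : ℝ, 0 < h → h < h₀ →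
        ∃ y₁, IsExactlyInitializedStep (M s) s f y t h y₁ ∧
          (∀ z, IsExactlyInitializedStep (M s) s f y t h z → z = y₁) ∧
          ‖y₁ - y (t + h)‖ ≤ C * h ^ (p + 1)

/-! Since `f` is evaluated only at past values, `y_{n+1}` enters linearly. Hence the local error `e`
solves `(I - h μ₋₁ J) e = -R(h)`, where `R` is the residual of the exact solution. For small `h` the
operator on the left is invertible and changes norms by at most a factor 2, so order `p` means
exactly `R = O(h ^ (p + 1))` (`exists_step_bound_iff`).

By Taylor expansion (`hasExpansion_residual`), the coefficient of `h ^ l` in `R` is, for `l ≥ 1`, a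
nonzero multiple of `E_l y⁽ˡ⁾ + l G_{l-1} J y⁽ˡ⁻¹⁾`, with `E` the explicit and `G` the Jacobian
defect. For `l = 2` the identity `y'' = J y'` merges the two terms, so only `E_2 + 2 G_1 = 0` is
needed.

Conversely, `y' = y` forces `E_l + l G_{l-1} = 0`, and for `l ≠ 2` the system `u' = 1`, `w' = u ^ (l
- 1)` started at the origin has `J = 0` and `w⁽ˡ⁾ ≠ 0`, which forces `E_l = 0`. -/

open Asymptotics Filter Topology

/-- `∑ l, h ^ l • v l` is an asymptotic expansion of `g h` as `h → 0⁺`. -/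
def HasExpansion {E : Type*} [NormedAddCommGroup E] [NormedSpace ℝ E]
    (g : ℝ → E) (v : ℕ → E) : Prop :=
  ∀ n : ℕ, (fun h => g h - ∑ l ∈ range n, h ^ l • v l) =O[𝓝[>] 0] fun h : ℝ => h ^ n

/-! ### Calculus and uniqueness of asymptotic expansions. -/

namespace HasExpansion

variable {E F : Type*} [NormedAddCommGroup E] [NormedSpace ℝ E]
  [NormedAddCommGroup F] [NormedSpace ℝ F] {g g' : ℝ → E} {v v' : ℕ → E}

theorem add (hg : HasExpansion g v) (hg' : HasExpansion g' v') :
    HasExpansion (fun h => g h + g' h) (fun l => v l + v' l) := by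
  intro n
  refine ((hg n).add (hg' n)).congr_left fun h => ?_
  simp only [smul_add, sum_add_distrib]
  abel

theorem map (hg : HasExpansion g v) (L : E →L[ℝ] F) :
    HasExpansion (fun h => L (g h)) (fun l => L (v l)) := by
  intro n
  refine ((L.isBigO_comp _ _).trans (hg n)).congr_left fun h => ?_
  simp

theorem const_smul (hg : HasExpansion g v) (r : ℝ) :
    HasExpansion (fun h => r • g h) (fun l => r • v l) :=
  hg.map (r • ContinuousLinearMap.id ℝ E)

theorem sub (hg : HasExpansion g v) (hg' : HasExpansion g' v') :
    HasExpansion (fun h => g h - g' h) (fun l => v l - v' l) := by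
  simpa [sub_eq_add_neg] using hg.add (hg'.const_smul (-1))

theorem sum {ι : Type*} (S : Finset ι) {g : ι → ℝ → E} {v : ι → ℕ → E}
    (hg : ∀ i ∈ S, HasExpansion (g i) (v i)) :
    HasExpansion (fun h => ∑ i ∈ S, g i h) (fun l => ∑ i ∈ S, v i l) := by
  intro n
  refine (IsBigO.sum fun i hi => hg i hi n).congr_left fun h => ?_
  simp only [Finset.sum_apply, sum_sub_distrib, smul_sum]
  rw [sum_comm]

theorem id_smul (hg : HasExpansion g v) :
    HasExpansion (fun h => h • g h) (fun l => Nat.casesOn l 0 v) := by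
  rintro (_ | n)
  · have h1 : (fun h : ℝ => h) =O[𝓝[>] 0] fun _ : ℝ => (1 : ℝ) :=
      ((continuous_id.tendsto (0 : ℝ)).mono_left nhdsWithin_le_nhds).isBigO_one ℝ
    simpa using h1.smul (hg 0)
  · refine ((isBigO_refl (fun h : ℝ => h) (𝓝[>] 0)).smul (hg n)).congr (fun h => ?_) fun h => ?_
    · rw [sum_range_succ']
      simp [smul_sub, smul_sum, smul_smul, pow_succ']
    · simp [pow_succ']

/-- Letting `h → 0⁺` kills the constant coefficient; dividing by `h` then lowers the degree. -/
theorem eq_zero_of_isBigO (n : ℕ) :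
    ∀ v : ℕ → E, (fun h : ℝ => ∑ l ∈ range n, h ^ l • v l) =O[𝓝[>] 0] (fun h : ℝ => h ^ n) →
      ∀ l < n, v l = 0 := by
  induction n with
  | zero => intro v _ l hl; omega
  | succ n ih =>
    intro v hv
    have h0 : v 0 = 0 := by
      have h1 : Tendsto (fun h : ℝ => ∑ l ∈ range (n + 1), h ^ l • v l) (𝓝[>] 0) (𝓝 (v 0)) := by
        have hc : Continuous fun h : ℝ => ∑ l ∈ range (n + 1), h ^ l • v l := by fun_prop
        have := (hc.tendsto 0).mono_left (nhdsWithin_le_nhds (s := Set.Ioi 0))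
        simpa [sum_range_succ'] using this
      have h2 : Tendsto (fun h : ℝ => h ^ (n + 1)) (𝓝[>] 0) (𝓝 0) := by
        have := ((continuous_pow (M := ℝ) (n + 1)).tendsto 0).mono_left
          (nhdsWithin_le_nhds (s := Set.Ioi 0))
        simpa using this
      exact tendsto_nhds_unique h1 (hv.trans_tendsto h2)
    have h1 := ih (fun l => v (l + 1)) (by
      refine ((isBigO_refl (fun h : ℝ => h⁻¹) (𝓝[>] 0)).smul hv).congr' ?_ ?_
      · filter_upwards [self_mem_nhdsWithin] with h hh
        have hh : h ≠ 0 := (Set.mem_Ioi.1 hh).ne'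
        rw [sum_range_succ', h0, smul_zero, add_zero, smul_sum]
        refine sum_congr rfl fun l _ => ?_
        rw [smul_smul, pow_succ']
        field_simp
      · filter_upwards [self_mem_nhdsWithin] with h hh
        have hh : h ≠ 0 := (Set.mem_Ioi.1 hh).ne'
        rw [smul_eq_mul, pow_succ']
        field_simp)
    rintro (_ | l) hl
    · exact h0
    · exact h1 l (by omega)

theorem isBigO_iff (hg : HasExpansion g v) (n : ℕ) :
    g =O[𝓝[>] 0] (fun h : ℝ => h ^ n) ↔ ∀ l < n, v l = 0 := by
  constructor
  · intro h
    exact eq_zero_of_isBigO n v ((h.sub (hg n)).congr_left fun h => by abel)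
  · intro h
    refine (hg n).congr_left fun x => ?_
    rw [sum_eq_zero fun l hl => by rw [h l (mem_range.1 hl), smul_zero], sub_zero]

end HasExpansion

/-! ### Taylor expansion along the grid. -/

section Taylor

variable {E : Type*} [NormedAddCommGroup E] [NormedSpace ℝ E] {D : ℕ → ℝ → E} {S : Set ℝ}

/-- Derivatives are carried by a chain `D` with `(D l)' = D (l + 1)`, which serves both general
solutions and explicit test solutions. -/
theorem iteratedDerivWithin_eq_of_hasDerivAt (hS : IsOpen S)
    (hD : ∀ l, ∀ x ∈ S, HasDerivAt (D l) (D (l + 1) x) x) (m l : ℕ) :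
    Set.EqOn (iteratedDerivWithin l (D m) S) (D (m + l)) S := by
  induction l with
  | zero => intro x _; simp
  | succ l ih =>
    intro x hx
    rw [iteratedDerivWithin_succ, derivWithin_congr ih (ih hx),
      derivWithin_of_isOpen hS hx, (hD _ x hx).deriv]
    rfl

theorem contDiffOn_of_hasDerivAt (hS : IsOpen S)
    (hD : ∀ l, ∀ x ∈ S, HasDerivAt (D l) (D (l + 1) x) x) (m n : ℕ) :
    ContDiffOn ℝ n (D m) S := by
  induction n generalizing m with
  | zero =>
    exact contDiffOn_zero.2 fun x hx => (hD m x hx).continuousAt.continuousWithinAt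
  | succ n ih =>
    push_cast
    rw [contDiffOn_succ_iff_deriv_of_isOpen hS]
    refine ⟨fun x hx => (hD m x hx).differentiableAt.differentiableWithinAt, by simp, ?_⟩
    exact (ih (m + 1)).congr fun x hx => (hD m x hx).deriv

theorem hasExpansion_taylor (hS : IsOpen S) (hc : Convex ℝ S)
    (hD : ∀ l, ∀ x ∈ S, HasDerivAt (D l) (D (l + 1) x) x) (m : ℕ) {t : ℝ} (ht : t ∈ S) (c : ℝ) :
    HasExpansion (fun h => D m (t - c * h))
      (fun l => ((-c) ^ l / (l.factorial : ℝ)) • D (m + l) t) := by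
  intro n
  have h1 := (taylor_isLittleO hc ht (contDiffOn_of_hasDerivAt hS hD m n)).isBigO
  rw [hS.nhdsWithin_eq ht] at h1
  have h2 : Tendsto (fun h : ℝ => t - c * h) (𝓝[>] 0) (𝓝 t) := by
    have : Continuous fun h : ℝ => t - c * h := by fun_prop
    simpa using (this.tendsto 0).mono_left (nhdsWithin_le_nhds (s := Set.Ioi 0))
  have h3 := h1.comp_tendsto h2
  have h4 : (fun h : ℝ => (t - c * h - t) ^ n) =O[𝓝[>] 0] fun h : ℝ => h ^ n := by
    refine ((isBigO_refl (fun h : ℝ => h ^ n) _).const_mul_left ((-c) ^ n)).congr_left fun h => ?_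
    rw [← mul_pow]; ring
  -- The Taylor polynomial of degree `n` has one term more than the sum over `range n`; that term is
  -- itself `O(h ^ n)`.
  have h5 : (fun h : ℝ => h ^ n • (((-c) ^ n / (n.factorial : ℝ)) • D (m + n) t))
      =O[𝓝[>] 0] fun h : ℝ => h ^ n := by
    simpa using (isBigO_refl (fun h : ℝ => h ^ n) (𝓝[>] 0)).smul
      (isBigO_const_const (((-c) ^ n / (n.factorial : ℝ)) • D (m + n) t) (one_ne_zero (α := ℝ)) _)
  refine ((h3.trans h4).add h5).congr_left fun h => ?_
  simp only [Function.comp, taylor_within_apply, sum_range_succ _ n]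
  have h6 : ∀ l, ((l.factorial : ℝ)⁻¹ * (t - c * h - t) ^ l) • iteratedDerivWithin l (D m) S t
      = h ^ l • (((-c) ^ l / (l.factorial : ℝ)) • D (m + l) t) := by
    intro l
    rw [iteratedDerivWithin_eq_of_hasDerivAt hS hD m l ht, smul_smul,
      show t - c * h - t = h * -c by ring, mul_pow]
    congr 1
    ring
  simp only [h6]
  abel

end Taylor

theorem sum_Icc_neg_one {G : Type*} [AddCommMonoid G] (k : ℕ) (F : ℤ → G) :
    ∑ i ∈ Icc (-1 : ℤ) (k - 1), F i = F (-1) + ∑ i ∈ Icc (0 : ℤ) (k - 1), F i := by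
  have h : Icc (-1 : ℤ) (k - 1) = insert (-1) (Icc (0 : ℤ) (k - 1)) := by
    ext i
    simp only [mem_Icc, mem_insert]
    omega
  rw [h, sum_insert (by simp)]

/-! ### The residual and its expansion. -/

namespace LimmCoeffs

variable {k : ℕ} {E : Type*} [NormedAddCommGroup E] [NormedSpace ℝ E]

/-- The residual of the method with Jacobian `J` when `u` with derivative `u'` is inserted. -/
noncomputable def residual (A : LimmCoeffs) (s : StepFractions k) (J : E →L[ℝ] E) (u u' : ℝ → E)
    (t h : ℝ) : E :=
  ∑ i ∈ Icc (-1 : ℤ) (k - 1), A.α i • u (t - s.c i * h)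
    - h • ∑ i ∈ Icc (0 : ℤ) (k - 1), A.β i • u' (t - s.c i * h)
    - h • J (∑ i ∈ Icc (-1 : ℤ) (k - 1), A.μ i • u (t - s.c i * h)
      + h • ∑ i ∈ Icc (0 : ℤ) (k - 1), A.ν i • u' (t - s.c i * h))

/-- The defect of order `l` of the explicit part of the method. -/
noncomputable def explicitDefect (A : LimmCoeffs) (s : StepFractions k) (l : ℕ) : ℝ :=
  ∑ i ∈ Icc (-1 : ℤ) (k - 1), A.α i * s.c i ^ l
    + l * ∑ i ∈ Icc (0 : ℤ) (k - 1), A.β i * s.c i ^ (l - 1)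

/-- The defect of order `l` of the part of the method that is multiplied by the Jacobian. -/
noncomputable def jacobianDefect (A : LimmCoeffs) (s : StepFractions k) (l : ℕ) : ℝ :=
  ∑ i ∈ Icc (-1 : ℤ) (k - 1), A.μ i * s.c i ^ l
    - l * ∑ i ∈ Icc (0 : ℤ) (k - 1), A.ν i * s.c i ^ (l - 1)

/-- The coefficients of the expansion of the residual in powers of the step size. -/
noncomputable def residualCoeff (A : LimmCoeffs) (s : StepFractions k) (J : E →L[ℝ] E) (d : ℕ → E) : ℕ → E
  | 0 => A.explicitDefect s 0 • d 0
  | l + 1 => ((-1) ^ (l + 1) / ((l + 1).factorial : ℝ)) •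
      (A.explicitDefect s (l + 1) • d (l + 1)
        + ((l + 1 : ℝ) * A.jacobianDefect s l) • J (d l))

theorem isExactlyInitializedStep_iff (A : LimmCoeffs) (s : StepFractions k) (f : E → E)
    (y : ℝ → E) (t h : ℝ) (z : E) :
    IsExactlyInitializedStep A s f y t h z ↔
      (z - y (t + h)) - (h * A.μ (-1)) • fderiv ℝ f (y t) (z - y (t + h))
        = - A.residual s (fderiv ℝ f (y t)) y (fun x => f (y x)) t h := by
  have h0 : ∀ i ∈ Icc (0 : ℤ) (k - 1),
      Function.update (fun i => y (t - s.c i * h)) (-1) z i = y (t - s.c i * h) := by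
    intro i hi
    have : i ≠ -1 := by have := (mem_Icc.1 hi).1; omega
    simp [this]
  have h1 : Function.update (fun i => y (t - s.c i * h)) (-1) z 0 = y t := by
    simp [s.zero]
  have e : ∀ a : ℤ → ℝ, ∑ i ∈ Icc (0 : ℤ) (k - 1),
      a i • f (Function.update (fun i => y (t - s.c i * h)) (-1) z i)
      = ∑ i ∈ Icc (0 : ℤ) (k - 1), a i • f (y (t - s.c i * h)) :=
    fun a => sum_congr rfl fun i hi => by rw [h0 i hi]
  have e' : ∀ a : ℤ → ℝ, ∑ i ∈ Icc (0 : ℤ) (k - 1),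
      a i • Function.update (fun i => y (t - s.c i * h)) (-1) z i
      = ∑ i ∈ Icc (0 : ℤ) (k - 1), a i • y (t - s.c i * h) :=
    fun a => sum_congr rfl fun i hi => by rw [h0 i hi]
  have hm : t - s.c (-1) * h = t + h := by rw [s.neg_one]; ring
  unfold IsExactlyInitializedStep IsLimmStep residual
  simp only [sum_Icc_neg_one, e, e', h1, Function.update_self, A.α_neg_one, hm, map_add, map_sub,
    map_smul, smul_add, smul_sub, one_smul, mul_smul]
  rw [← sub_eq_zero, ← sub_eq_zero (b := -_)]
  refine Eq.congr ?_ rfl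
  abel

theorem hasExpansion_residual (A : LimmCoeffs) (s : StepFractions k) (J : E →L[ℝ] E)
    {D : ℕ → ℝ → E} {S : Set ℝ} (hS : IsOpen S) (hc : Convex ℝ S)
    (hD : ∀ l, ∀ x ∈ S, HasDerivAt (D l) (D (l + 1) x) x) {t : ℝ} (ht : t ∈ S) :
    HasExpansion (A.residual s J (D 0) (D 1) t) (A.residualCoeff s J (fun l => D l t)) := by
  have hs : ∀ (m : ℕ) (T : Finset ℤ) (a : ℤ → ℝ),
      HasExpansion (fun h => ∑ i ∈ T, a i • D m (t - s.c i * h))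
        (fun l => ((-1) ^ l / (l.factorial : ℝ)) • (∑ i ∈ T, a i * s.c i ^ l) • D (m + l) t) := by
    intro m T a
    convert HasExpansion.sum T
      (fun i _ => (hasExpansion_taylor hS hc hD m ht (s.c i)).const_smul (a i)) using 2 with l
    rw [sum_smul, smul_sum]
    refine sum_congr rfl fun i _ => ?_
    rw [smul_smul, smul_smul, neg_pow]
    congr 1
    ring
  have key := (((hs 0 (Icc (-1 : ℤ) (k - 1)) A.α).sub (hs 1 (Icc (0 : ℤ) (k - 1)) A.β).id_smul).sub
    (((hs 0 (Icc (-1 : ℤ) (k - 1)) A.μ).add (hs 1 (Icc (0 : ℤ) (k - 1)) A.ν).id_smul).map J).id_smul)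
  refine Eq.subst (motive := HasExpansion _) (funext fun l => ?_) key
  have fac : ∀ n : ℕ, ((n + 1).factorial : ℝ) = (n + 1) * n.factorial := by
    intro n; push_cast [Nat.factorial_succ]; ring
  have fne : ∀ n : ℕ, (n.factorial : ℝ) ≠ 0 := fun n => by exact_mod_cast n.factorial_ne_zero
  have nne : ∀ n : ℕ, (n : ℝ) + 1 ≠ 0 := fun n => by positivity
  -- The `β` and `μ` sums carry one factor `h` and the `ν` sum two, so orders 0 and 1 lack some of
  -- the terms.
  rcases l with _ | _ | l
  · simp [residualCoeff, explicitDefect]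
  · dsimp only [residualCoeff]
    simp only [explicitDefect, jacobianDefect, map_smul, Nat.rec_zero, add_zero, zero_add,
      Nat.factorial_one, Nat.factorial_zero, pow_one, pow_zero, Nat.cast_zero, Nat.cast_one,
      zero_mul, one_mul, mul_one, sub_zero, Nat.sub_self]
    module
  · simp only [residualCoeff, explicitDefect, jacobianDefect, map_add, map_smul, zero_add,
      Nat.add_sub_cancel, fac, add_comm 1, smul_add, smul_smul, ← sub_smul]
    have := fne l
    have := nne l
    have := nne (l + 1)
    push_cast at *
    match_scalars
    · field_simp
      ring
    · field_simp
      ring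

end LimmCoeffs

/-! ### Solvability of the step and size of the error. -/

theorem half_norm_le_norm_sub {E : Type*} [NormedAddCommGroup E] [NormedSpace ℝ E]
    {T : E →L[ℝ] E} (hT : ‖T‖ ≤ 1 / 2) (v : E) : ‖v‖ / 2 ≤ ‖v - T v‖ := by
  have h1 := norm_sub_norm_le v (T v)
  have h2 := T.le_of_opNorm_le hT v
  linarith

theorem norm_sub_le_two_mul {E : Type*} [NormedAddCommGroup E] [NormedSpace ℝ E]
    {T : E →L[ℝ] E} (hT : ‖T‖ ≤ 1 / 2) (v : E) : ‖v - T v‖ ≤ 2 * ‖v‖ := by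
  have h1 := norm_sub_le v (T v)
  have h2 := T.le_of_opNorm_le hT v
  linarith [norm_nonneg v]

theorem bijective_sub_of_norm_le_half {E : Type*} [NormedAddCommGroup E] [NormedSpace ℝ E]
    [FiniteDimensional ℝ E] {T : E →L[ℝ] E} (hT : ‖T‖ ≤ 1 / 2) :
    Function.Bijective fun v => v - T v := by
  have hinj : Function.Injective ((LinearMap.id : E →ₗ[ℝ] E) - (T : E →ₗ[ℝ] E)) := by
    rw [injective_iff_map_eq_zero]
    intro v hv
    have h1 := half_norm_le_norm_sub hT v
    have h2 : v - T v = 0 := hv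
    rw [h2, norm_zero] at h1
    exact norm_le_zero_iff.1 (by linarith)
  exact ⟨hinj, LinearMap.injective_iff_surjective.1 hinj⟩

namespace LimmCoeffs

variable {k : ℕ} {E : Type*} [NormedAddCommGroup E] [NormedSpace ℝ E]

theorem exists_step_bound_iff [FiniteDimensional ℝ E] (A : LimmCoeffs) (s : StepFractions k)
    (f : E → E) (y : ℝ → E) (t : ℝ) (n : ℕ) :
    (∃ C h₀ : ℝ, 0 < h₀ ∧ ∀ h : ℝ, 0 < h → h < h₀ →
        ∃ y₁, IsExactlyInitializedStep A s f y t h y₁ ∧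
          (∀ z, IsExactlyInitializedStep A s f y t h z → z = y₁) ∧
          ‖y₁ - y (t + h)‖ ≤ C * h ^ n) ↔
      A.residual s (fderiv ℝ f (y t)) y (fun x => f (y x)) t =O[𝓝[>] 0] fun h : ℝ => h ^ n := by
  set J := fderiv ℝ f (y t)
  set R := A.residual s J y (fun x => f (y x)) t
  have hsmall : ∀ᶠ h : ℝ in 𝓝[>] 0, ‖(h * A.μ (-1)) • J‖ ≤ 1 / 2 := by
    have hc : Continuous fun h : ℝ => ‖(h * A.μ (-1)) • J‖ := by fun_prop
    have := (hc.tendsto 0).mono_left (nhdsWithin_le_nhds (s := Set.Ioi 0))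
    simp only [zero_mul, zero_smul, norm_zero] at this
    exact this.eventually_le_const (by norm_num)
  constructor
  · rintro ⟨C, h₀, hh₀, H⟩
    refine IsBigO.of_bound (2 * C) ?_
    filter_upwards [hsmall, Ioo_mem_nhdsGT hh₀] with h hT hh
    obtain ⟨y₁, hy₁, -, hb⟩ := H h hh.1 hh.2
    rw [isExactlyInitializedStep_iff] at hy₁
    have h1 := norm_sub_le_two_mul hT (y₁ - y (t + h))
    rw [_root_.smul_apply, hy₁, norm_neg] at h1
    rw [Real.norm_of_nonneg (pow_nonneg hh.1.le n)]
    linarith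
  · intro H
    obtain ⟨C, hC⟩ := H.bound
    obtain ⟨h₀, hh₀, H⟩ := mem_nhdsGT_iff_exists_Ioo_subset.1 (hsmall.and hC)
    refine ⟨2 * C, h₀, hh₀, fun h hpos hlt => ?_⟩
    obtain ⟨hT, hb⟩ := H ⟨hpos, hlt⟩
    obtain ⟨hinj, hsurj⟩ := bijective_sub_of_norm_le_half hT
    obtain ⟨v, hv⟩ := hsurj (-R h)
    refine ⟨v + y (t + h), ?_, fun z hz => ?_, ?_⟩
    · rw [isExactlyInitializedStep_iff, add_sub_cancel_right]
      exact hv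
    · rw [isExactlyInitializedStep_iff] at hz
      exact sub_eq_iff_eq_add.1 (hinj (hz.trans hv.symm))
    · rw [add_sub_cancel_right]
      have h1 := half_norm_le_norm_sub hT v
      have hv' : v - ((h * A.μ (-1)) • J) v = -R h := hv
      rw [hv', norm_neg] at h1
      rw [Real.norm_of_nonneg (pow_nonneg hpos.le n)] at hb
      linarith

/-- The equation `f (D 0 x) = D 1 x` is known only on `S`, but for small `h` all past grid points
lie in `S`. -/
theorem exists_step_bound_iff_residualCoeff [FiniteDimensional ℝ E] (A : LimmCoeffs)
    (s : StepFractions k) (f : E → E) {D : ℕ → ℝ → E} {S : Set ℝ} (hS : IsOpen S)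
    (hc : Convex ℝ S) (hD : ∀ l, ∀ x ∈ S, HasDerivAt (D l) (D (l + 1) x) x)
    (hf : ∀ x ∈ S, f (D 0 x) = D 1 x) {t : ℝ} (ht : t ∈ S) (n : ℕ) :
    (∃ C h₀ : ℝ, 0 < h₀ ∧ ∀ h : ℝ, 0 < h → h < h₀ →
        ∃ y₁, IsExactlyInitializedStep A s f (D 0) t h y₁ ∧
          (∀ z, IsExactlyInitializedStep A s f (D 0) t h z → z = y₁) ∧
          ‖y₁ - D 0 (t + h)‖ ≤ C * h ^ n) ↔
      ∀ l < n, A.residualCoeff s (fderiv ℝ f (D 0 t)) (fun l => D l t) l = 0 := by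
  rw [exists_step_bound_iff, ← (A.hasExpansion_residual s _ hS hc hD ht).isBigO_iff]
  refine isBigO_congr ?_ EventuallyEq.rfl
  have h1 : ∀ᶠ h : ℝ in 𝓝[>] 0, ∀ i ∈ Icc (0 : ℤ) (k - 1), t - s.c i * h ∈ S := by
    rw [eventually_all_finset]
    intro i _
    have hcont : Continuous fun h : ℝ => t - s.c i * h := by fun_prop
    refine ((hcont.tendsto 0).mono_left nhdsWithin_le_nhds).eventually (hS.mem_nhds ?_)
    simpa using ht
  filter_upwards [h1] with h hh
  have e : ∀ a : ℤ → ℝ, ∑ i ∈ Icc (0 : ℤ) (k - 1), a i • f (D 0 (t - s.c i * h))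
      = ∑ i ∈ Icc (0 : ℤ) (k - 1), a i • D 1 (t - s.c i * h) :=
    fun a => sum_congr rfl fun i hi => by rw [hf _ (hh i hi)]
  simp only [residual, e]

end LimmCoeffs

/-! ### Smoothness of solutions and sufficiency of the conditions. -/

theorem contDiffOn_of_isSolution {E : Type*} [NormedAddCommGroup E] [NormedSpace ℝ E]
    {U : Set E} {f : E → E} (hf : ContDiffOn ℝ ∞ f U) {S : Set ℝ} (hS : IsOpen S) {y : ℝ → E}
    (hy : ∀ t ∈ S, y t ∈ U ∧ HasDerivAt y (f (y t)) t) (n : ℕ) : ContDiffOn ℝ n y S := by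
  induction n with
  | zero => exact contDiffOn_zero.2 fun x hx => (hy x hx).2.continuousAt.continuousWithinAt
  | succ n ih =>
    push_cast
    rw [contDiffOn_succ_iff_deriv_of_isOpen hS]
    refine ⟨fun x hx => (hy x hx).2.differentiableAt.differentiableWithinAt, by simp, ?_⟩
    exact ((hf.of_le (by exact_mod_cast le_top)).comp ih fun x hx => (hy x hx).1).congr
      fun x hx => (hy x hx).2.deriv

theorem hasDerivAt_iteratedDerivWithin {E : Type*} [NormedAddCommGroup E] [NormedSpace ℝ E]
    {S : Set ℝ} (hS : IsOpen S) {y : ℝ → E} (hy : ∀ n : ℕ, ContDiffOn ℝ n y S) (l : ℕ) {x : ℝ}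
    (hx : x ∈ S) :
    HasDerivAt (iteratedDerivWithin l y S) (iteratedDerivWithin (l + 1) y S x) x := by
  rw [iteratedDerivWithin_succ]
  have h := (hy (l + 1)).differentiableOn_iteratedDerivWithin (m := l)
    (by exact_mod_cast l.lt_succ_self) hS.uniqueDiffOn x hx
  exact h.hasDerivWithinAt.hasDerivAt (hS.mem_nhds hx)

namespace VariableStepLimm

variable {k : ℕ} {M : VariableStepLimm k} {s : StepFractions k} {p : ℕ}

theorem hasConsistencyOrder_of_defect (h0 : (M s).explicitDefect s 0 = 0)
    (h1 : p ≠ 0 → (M s).explicitDefect s 1 = 0 ∧ (M s).jacobianDefect s 0 = 0)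
    (h2 : 2 ≤ p → (M s).explicitDefect s 2 + 2 * (M s).jacobianDefect s 1 = 0)
    (h3 : ∀ l, 3 ≤ l → l ≤ p →
      (M s).explicitDefect s l = 0 ∧ (M s).jacobianDefect s (l - 1) = 0) :
    M.HasConsistencyOrder s p := by
  intro d U f hU hf a b y hy t ht
  have hS : IsOpen (Set.Ioo a b) := isOpen_Ioo
  have hD := fun l x hx => hasDerivAt_iteratedDerivWithin hS (contDiffOn_of_isSolution hf hS hy) l
    (x := x) hx
  have hy1 : ∀ x ∈ Set.Ioo a b, f (y x) = iteratedDerivWithin 1 y (Set.Ioo a b) x := by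
    intro x hx
    rw [iteratedDerivWithin_one, derivWithin_of_isOpen hS hx, (hy x hx).2.deriv]
  have key := (M s).exists_step_bound_iff_residualCoeff s f
    (D := fun l => iteratedDerivWithin l y (Set.Ioo a b)) hS (convex_Ioo a b) hD
    (by simpa using hy1) ht (p + 1)
  simp only [iteratedDerivWithin_zero] at key
  rw [key]
  rintro (_ | _ | _ | l) hl
  · simp [LimmCoeffs.residualCoeff, h0]
  · simp [LimmCoeffs.residualCoeff, h1 (by omega)]
  -- The chain rule applied to `y' = f(y)` makes both terms of order 2 multiples of the same vector.
  · have e : iteratedDerivWithin 2 y (Set.Ioo a b) t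
        = fderiv ℝ f (y t) (iteratedDerivWithin 1 y (Set.Ioo a b) t) := by
      have hfd : HasFDerivAt f (fderiv ℝ f (y t)) (y t) :=
        ((hf.contDiffAt (hU.mem_nhds (hy t ht).1)).differentiableAt (by simp)).hasFDerivAt
      have hcomp := hfd.comp_hasDerivAt t (hy t ht).2
      rw [hy1 t ht] at hcomp
      refine (hD 1 t ht).unique (hcomp.congr_of_eventuallyEq ?_)
      filter_upwards [hS.mem_nhds ht] with x hx using (hy1 x hx).symm
    simp only [LimmCoeffs.residualCoeff, e, ← add_smul, Nat.cast_one,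
      one_add_one_eq_two, h2 (by omega), zero_smul, smul_zero]
  · have := h3 (l + 3) (by omega) (by omega)
    simp only [show l + 3 - 1 = l + 2 by omega] at this
    simp [LimmCoeffs.residualCoeff, this]

end VariableStepLimm

/-! ### Necessity by test equations. -/

namespace VariableStepLimm

variable {k : ℕ} {M : VariableStepLimm k} {s : StepFractions k} {p : ℕ}

theorem HasConsistencyOrder.residualCoeff_eq_zero (H : M.HasConsistencyOrder s p) {d : ℕ}
    {f : EuclideanSpace ℝ (Fin d) → EuclideanSpace ℝ (Fin d)} (hf : ContDiff ℝ ∞ f)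
    {D : ℕ → ℝ → EuclideanSpace ℝ (Fin d)} (hD : ∀ l x, HasDerivAt (D l) (D (l + 1) x) x)
    (hDf : ∀ x, f (D 0 x) = D 1 x) {l : ℕ} (hl : l ≤ p) :
    (M s).residualCoeff s (fderiv ℝ f (D 0 0)) (fun l => D l 0) l = 0 := by
  refine ((M s).exists_step_bound_iff_residualCoeff s f (isOpen_Ioo (a := -1) (b := 1))
    (convex_Ioo _ _) (fun l x _ => hD l x) (fun x _ => hDf x) (by norm_num) (p + 1)).1
    (H d Set.univ f isOpen_univ hf.contDiffOn (-1) 1 (D 0)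
      (fun x _ => ⟨Set.mem_univ _, by rw [hDf]; exact hD 0 x⟩) 0 (by norm_num)) l (by omega)

/-- Test equation `y' = y` in dimension one: `J` is the identity and all derivatives agree at 0. -/
theorem HasConsistencyOrder.residualCoeff_exp (H : M.HasConsistencyOrder s p) {l : ℕ}
    (hl : l ≤ p) : (M s).residualCoeff s (ContinuousLinearMap.id ℝ (EuclideanSpace ℝ (Fin 1)))
      (fun _ => EuclideanSpace.single 0 1) l = 0 := by
  have h := H.residualCoeff_eq_zero (f := id)
    (D := fun _ x => Real.exp x • (EuclideanSpace.single (0 : Fin 1) (1 : ℝ)))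
    contDiff_id (fun _ x => (Real.hasDerivAt_exp x).smul_const _) (fun _ => rfl) hl
  simpa using h

theorem HasConsistencyOrder.explicitDefect_zero (H : M.HasConsistencyOrder s p) :
    (M s).explicitDefect s 0 = 0 := by
  simpa [LimmCoeffs.residualCoeff] using H.residualCoeff_exp (Nat.zero_le p)

theorem HasConsistencyOrder.explicitDefect_add_jacobianDefect (H : M.HasConsistencyOrder s p)
    {l : ℕ} (hl : l + 1 ≤ p) :
    (M s).explicitDefect s (l + 1) + (l + 1) * (M s).jacobianDefect s l = 0 := by
  have h := H.residualCoeff_exp hl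
  simp only [LimmCoeffs.residualCoeff, ContinuousLinearMap.id_apply, ← add_smul] at h
  simpa [Nat.factorial_ne_zero] using h

theorem fderiv_single_add_pow_smul_single_eq_zero {m : ℕ} (hm : m ≠ 1) :
    fderiv ℝ (fun v : EuclideanSpace ℝ (Fin 2) => EuclideanSpace.single (0 : Fin 2) (1 : ℝ)
      + v 0 ^ m • EuclideanSpace.single (1 : Fin 2) (1 : ℝ)) 0 = 0 := by
  have h0 : HasFDerivAt (fun v : EuclideanSpace ℝ (Fin 2) => v 0)
      (EuclideanSpace.proj 0 : EuclideanSpace ℝ (Fin 2) →L[ℝ] ℝ) 0 :=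
    (EuclideanSpace.proj 0 : EuclideanSpace ℝ (Fin 2) →L[ℝ] ℝ).hasFDerivAt
  refine (((h0.pow m).smul_const (EuclideanSpace.single (1 : Fin 2) (1 : ℝ))).const_add _).fderiv.trans ?_
  rcases m with _ | _ | m
  · ext; simp
  · exact absurd rfl hm
  · ext; simp

/-- The test solution `(x, x ^ (l + 1) / (l + 1))` starts at the origin, where the Jacobian vanishes
unless `l = 1`, so the explicit defect stands alone. -/
theorem HasConsistencyOrder.explicitDefect_eq_zero (H : M.HasConsistencyOrder s p)
    {l : ℕ} (hl : l + 1 ≤ p) (hl1 : l ≠ 1) : (M s).explicitDefect s (l + 1) = 0 := by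
  have hne : (l : ℝ) + 1 ≠ 0 := by positivity
  have hx : ContDiff ℝ ∞ fun x : ℝ => x := contDiff_id
  have hp : ContDiff ℝ ∞ fun x : ℝ => x ^ (l + 1) := contDiff_id.pow _
  have hderiv : ∀ {g : ℝ → ℝ}, ContDiff ℝ ∞ g → ∀ (j : ℕ) (x : ℝ),
      HasDerivAt (iteratedDeriv j g) (iteratedDeriv (j + 1) g x) x := by
    intro g hg j x
    rw [iteratedDeriv_succ]
    exact (hg.differentiable_iteratedDeriv j (by exact_mod_cast ENat.natCast_lt_top j) x).hasDerivAt
  have h := H.residualCoeff_eq_zero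
    (f := fun v : EuclideanSpace ℝ (Fin 2) => EuclideanSpace.single (0 : Fin 2) (1 : ℝ)
      + v 0 ^ l • EuclideanSpace.single (1 : Fin 2) (1 : ℝ))
    (D := fun j x => iteratedDeriv j (fun x : ℝ => x) x • EuclideanSpace.single (0 : Fin 2) (1 : ℝ)
      + ((l + 1 : ℝ)⁻¹ * iteratedDeriv j (fun x : ℝ => x ^ (l + 1)) x)
        • EuclideanSpace.single (1 : Fin 2) (1 : ℝ))
    (by fun_prop)
    (fun j x => ((hderiv hx j x).smul_const _).add
      (((hderiv hp j x).const_mul _).smul_const _))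
    (fun x => by
      ext i
      fin_cases i
      · simp
      · simp
        field_simp)
    hl
  have h0 : iteratedDeriv 0 (fun x : ℝ => x) 0 • EuclideanSpace.single (0 : Fin 2) (1 : ℝ)
      + ((l + 1 : ℝ)⁻¹ * iteratedDeriv 0 (fun x : ℝ => x ^ (l + 1)) 0)
        • EuclideanSpace.single (1 : Fin 2) (1 : ℝ) = 0 := by simp
  simp only [h0, fderiv_single_add_pow_smul_single_eq_zero hl1, LimmCoeffs.residualCoeff,
    zero_apply, smul_zero, add_zero] at h
  simp only [iteratedDeriv_fun_pow_zero] at h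
  -- The second coordinate of the derivative of order `l + 1` is `l!`, which is nonzero.
  have h1 := congrArg (fun v : EuclideanSpace ℝ (Fin 2) => v 1) h
  simpa [Nat.factorial_ne_zero, hne] using h1

theorem hasConsistencyOrder_iff_defect : M.HasConsistencyOrder s p ↔
    (M s).explicitDefect s 0 = 0 ∧
    (p ≠ 0 → (M s).explicitDefect s 1 = 0 ∧ (M s).jacobianDefect s 0 = 0) ∧
    (2 ≤ p → (M s).explicitDefect s 2 + 2 * (M s).jacobianDefect s 1 = 0) ∧
    (∀ l, 3 ≤ l → l ≤ p →
      (M s).explicitDefect s l = 0 ∧ (M s).jacobianDefect s (l - 1) = 0) := by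
  refine ⟨fun H => ?_, fun ⟨h0, h1, h2, h3⟩ => hasConsistencyOrder_of_defect h0 h1 h2 h3⟩
  have key : ∀ l, l + 1 ≤ p → l ≠ 1 →
      (M s).explicitDefect s (l + 1) = 0 ∧ (M s).jacobianDefect s l = 0 := by
    intro l hl hl1
    have h1 := H.explicitDefect_eq_zero hl hl1
    have h2 := H.explicitDefect_add_jacobianDefect hl
    rw [h1, zero_add] at h2
    exact ⟨h1, (mul_eq_zero.1 h2).resolve_left (by positivity)⟩
  refine ⟨H.explicitDefect_zero, fun hp => key 0 (by omega) (by omega), fun hp => ?_, ?_⟩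
  · have h := H.explicitDefect_add_jacobianDefect (l := 1) hp
    norm_num at h
    exact h
  · intro l hl hlp
    obtain ⟨l, rfl⟩ : ∃ m, l = m + 1 := ⟨l - 1, by omega⟩
    exact key l hlp (by omega)

end VariableStepLimm

/-! ### Defects rewritten as the stated sums. -/

theorem mainTheorem1 (k : ℕ) (hk : 1 ≤ k) (M : VariableStepLimm k) (s : StepFractions k)
    (p : ℕ) (hp : 1 ≤ p) :
    M.HasConsistencyOrder s p ↔
      (∑ i ∈ Icc (-1 : ℤ) (k - 1), (M s).α i = 0) ∧
      (∑ i ∈ Icc (-1 : ℤ) (k - 1), (M s).μ i = 0) ∧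
      (∑ i ∈ Icc (-1 : ℤ) (k - 1), (M s).α i * s.c i
        + ∑ i ∈ Icc (0 : ℤ) (k - 1), (M s).β i = 0) ∧
      (2 ≤ p →
        ∑ i ∈ Icc (-1 : ℤ) (k - 1), (M s).α i * s.c i ^ 2
          + 2 * (∑ i ∈ Icc (0 : ℤ) (k - 1), (M s).β i * s.c i
            + ∑ i ∈ Icc (-1 : ℤ) (k - 1), (M s).μ i * s.c i
            - ∑ i ∈ Icc (0 : ℤ) (k - 1), (M s).ν i) = 0) ∧
      (∀ l : ℕ, 3 ≤ l → l ≤ p →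
        ∑ i ∈ Icc (-1 : ℤ) (k - 1), (M s).α i * s.c i ^ l
          + (l : ℝ) * ∑ i ∈ Icc (0 : ℤ) (k - 1), (M s).β i * s.c i ^ (l - 1) = 0) ∧
      (∀ l : ℕ, 3 ≤ l → l ≤ p →
        ∑ i ∈ Icc (-1 : ℤ) (k - 1), (M s).μ i * s.c i ^ (l - 1)
          - ((l : ℝ) - 1) * ∑ i ∈ Icc (0 : ℤ) (k - 1), (M s).ν i * s.c i ^ (l - 2) = 0) := by
  rw [VariableStepLimm.hasConsistencyOrder_iff_defect]
  have e0 : (M s).explicitDefect s 0 = ∑ i ∈ Icc (-1 : ℤ) (k - 1), (M s).α i := by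
    -- The factor `l = 0` removes the `β` sum with its truncated exponent `0 - 1`.
    simp [LimmCoeffs.explicitDefect]
  have e1 : (M s).explicitDefect s 1 = ∑ i ∈ Icc (-1 : ℤ) (k - 1), (M s).α i * s.c i
      + ∑ i ∈ Icc (0 : ℤ) (k - 1), (M s).β i := by
    simp [LimmCoeffs.explicitDefect]
  have j0 : (M s).jacobianDefect s 0 = ∑ i ∈ Icc (-1 : ℤ) (k - 1), (M s).μ i := by
    simp [LimmCoeffs.jacobianDefect]
  have e2 : (M s).explicitDefect s 2 + 2 * (M s).jacobianDefect s 1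
      = ∑ i ∈ Icc (-1 : ℤ) (k - 1), (M s).α i * s.c i ^ 2
          + 2 * (∑ i ∈ Icc (0 : ℤ) (k - 1), (M s).β i * s.c i
            + ∑ i ∈ Icc (-1 : ℤ) (k - 1), (M s).μ i * s.c i
            - ∑ i ∈ Icc (0 : ℤ) (k - 1), (M s).ν i) := by
    simp [LimmCoeffs.explicitDefect, LimmCoeffs.jacobianDefect]
    ring
  have j3 : ∀ l, 3 ≤ l → (M s).jacobianDefect s (l - 1)
      = ∑ i ∈ Icc (-1 : ℤ) (k - 1), (M s).μ i * s.c i ^ (l - 1)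
          - ((l : ℝ) - 1) * ∑ i ∈ Icc (0 : ℤ) (k - 1), (M s).ν i * s.c i ^ (l - 2) := by
    intro l hl
    rw [LimmCoeffs.jacobianDefect, Nat.cast_sub (by omega), Nat.cast_one, Nat.sub_sub]
  rw [e0, e1, j0, e2]
  constructor
  · rintro ⟨h0, h1, h2, h3⟩
    refine ⟨h0, (h1 (by omega)).2, (h1 (by omega)).1, h2, fun l hl hlp => (h3 l hl hlp).1,
      fun l hl hlp => ?_⟩
    rw [← j3 l hl]
    exact (h3 l hl hlp).2
  · rintro ⟨h0, h1, h1', h2, h3, h4⟩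
    refine ⟨h0, fun _ => ⟨h1', h1⟩, h2, fun l hl hlp => ⟨h3 l hl hlp, ?_⟩⟩
    rw [j3 l hl]
    exact h4 l hl hlp
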